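/- An algebraic formula over a field $\mathbb F$ in the variables $x_1,\dots,x_n$ is a rooted binary tree whose leaves are labelled by variables or by constants from $\mathbb F$ and whose inner vertices are sum or product gates; it computes a polynomial in $\mathbb F[x_1,\dots,x_n]$ in the natural way. Its size is the number of its leaves that are labelled by variables (so the size is at most the number of all leaves and at most the number of all vertices). For $d\in\mathbb N$ let $$\mathrm{esym}(n,d)=\sum_{S\subseteq[n],\ |S|=d}\ \prod_{j\in S}x_j .$$ There are absolute constants $c,C>0$ and $N\in\mathbb N$ such that the following holds for every $n\ge N$, every field $\mathbb F$, and $d=0.1n$, where, if $10\nmid n$, the number $0.1n$ may be rounded either down or up. (1) If the characteristic of $\mathbb F$ is $0$ or greater than $0.1n$, then every algebraic formula over $\mathbb F$ that computes $\mathrm{esym}(n,d)$ has size at least $c\,n^2$. (2) (Ben-Or's matching upper bound.) If $\mathbb F$ has more than $n$ elements, then $\mathrm{esym}(n,d)$ is computed by an algebraic formula over $\mathbb F$ with at most $C\,n^2$ vertices, and hence of size at most $C\,n^2$. -/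

import Mathlib

/-- Algebraic formulas over `F` in variables indexed by `σ`: rooted trees whose leaves are labelled by
variables or field constants and whose inner vertices are binary sum and product gates. -/
inductive AlgFormula (F : Type*) (σ : Type*) where
  | var (i : σ) : AlgFormula F σ
  | const (a : F) : AlgFormula F σ
  | add (Φ Ψ : AlgFormula F σ) : AlgFormula F σ
  | mul (Φ Ψ : AlgFormula F σ) : AlgFormula F σ

namespace AlgFormula

/-- The (formal) polynomial computed by a formula. -/
noncomputable def toPoly {F σ : Type*} [CommSemiring F] : AlgFormula F σ → MvPolynomial σ F
  | var i => MvPolynomial.X i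
  | const a => MvPolynomial.C a
  | add Φ Ψ => Φ.toPoly + Ψ.toPoly
  | mul Φ Ψ => Φ.toPoly * Ψ.toPoly

/-- The size of a formula: the number of leaves labelled by variables (leaves labelled by
constants are free). It is at most the number of all leaves, and the number of all vertices. -/
def size {F σ : Type*} : AlgFormula F σ → ℕ
  | var _ => 1
  | const _ => 0
  | add Φ Ψ => Φ.size + Ψ.size
  | mul Φ Ψ => Φ.size + Ψ.size

/-- The number of all vertices (leaves of both kinds, and gates) of a formula. -/
def numVertices {F σ : Type*} : AlgFormula F σ → ℕ
  | var _ => 1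
  | const _ => 1
  | add Φ Ψ => Φ.numVertices + Ψ.numVertices + 1
  | mul Φ Ψ => Φ.numVertices + Ψ.numVertices + 1

end AlgFormula

section

open MvPolynomial

/-! Lower bound: repeatedly cutting out subformulas of formal degree about `d / 2` writes the
computed polynomial as a sum of `t` products plus a remainder `r` of degree below `d`, each cut
costing `d / 2` leaves. After moving constants into `r`, all factors vanish at the origin, so `esymm
d - r` lies in `I ^ 2` with `I` generated by `2 * t` polynomials (`exists_sub_mem_sq`). Partial
derivatives then lie in `I`. Modulo `esymm 1, ..., esymm (d - 1)`, the `j`-th derivative of `esymm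
d` is `(-X j) ^ (d - 1)`, so adding these `d - 1` generators to `I` makes the quotient
finite-dimensional. The origin is thus an isolated common zero of `2 * t + d - 1` polynomials, and
Krull's height theorem gives `n ≤ 2 * t + d - 1`. For `d` near `n / 10`, both `t` and `d / 2` are
linear in `n`. Upper bound: `esymm d` is a coefficient of `∏ (1 + a * X i)` as a polynomial in `a`,
recovered by interpolation at `n + 1` points. -/

theorem Derivation.mem_of_mem_sq {R A : Type*} [CommSemiring R] [CommRing A] [Algebra R A]
    (δ : Derivation R A A) {I : Ideal A} {a : A} (ha : a ∈ I ^ 2) : δ a ∈ I := by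
  rw [pow_two] at ha
  refine Submodule.mul_induction_on ha (fun x hx y hy => ?_) (fun x y hx hy => ?_)
  · rw [Derivation.leibniz, smul_eq_mul, smul_eq_mul]
    exact I.add_mem (I.mul_mem_right _ hx) (I.mul_mem_right _ hy)
  · rw [map_add]
    exact I.add_mem hx hy

namespace MvPolynomial

/-! ### Derivatives of elementary symmetric polynomials. -/

theorem totalDegree_pderiv_lt {σ R : Type*} [CommSemiring R] (j : σ) {f : MvPolynomial σ R} {e : ℕ}
    (he : 0 < e) (hf : f.totalDegree < e + 1) : (pderiv j f).totalDegree < e := by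
  rw [totalDegree, Finset.sup_lt_iff (by simpa using he)]
  intro m hm
  rw [mem_support_iff, coeff_pderiv] at hm
  have h1 : m + Finsupp.single j 1 ∈ f.support :=
    mem_support_iff.2 (left_ne_zero_of_mul hm)
  have h2 := le_totalDegree h1
  rw [Finsupp.sum_add_index' (by simp) (by simp)] at h2
  simp at h2
  omega

theorem pderiv_prod_X {σ R : Type*} [DecidableEq σ] [CommRing R] (j : σ) (s : Finset σ) :
    pderiv j (∏ i ∈ s, (X i : MvPolynomial σ R)) =
      if j ∈ s then ∏ i ∈ s.erase j, X i else 0 := by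
  induction s using Finset.induction_on with
  | empty => simp
  | insert a s ha ih =>
    rw [Finset.prod_insert ha, pderiv_mul, ih, pderiv_X]
    by_cases h : a = j
    · subst h
      simp [ha]
    · have h' : j ≠ a := fun e => h e.symm
      rw [Pi.single_eq_of_ne h, Finset.erase_insert_of_ne h]
      by_cases hj : j ∈ s
      · rw [if_pos hj, if_pos (Finset.mem_insert_of_mem hj),
          Finset.prod_insert (fun e => ha (Finset.mem_of_mem_erase e))]
        ring
      · simp [hj, h']

/-- Among the `k`-subsets, those avoiding `j` contribute the first summand and those containing `j`
the second. -/
theorem pderiv_esymm_succ_add {σ R : Type*} [Fintype σ] [CommRing R] (j : σ) (k : ℕ) :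
    pderiv j (esymm σ R (k + 1)) + X j * pderiv j (esymm σ R k) = esymm σ R k := by
  classical
  simp only [esymm, map_sum, pderiv_prod_X]
  rw [Finset.mul_sum, ← Finset.sum_filter,
    ← Finset.sum_filter_add_sum_filter_not (Finset.powersetCard k Finset.univ) (fun s => j ∈ s)
      (fun s => ∏ i ∈ s, (X i : MvPolynomial σ R)), add_comm]
  congr 1
  · rw [Finset.sum_filter]
    refine Finset.sum_congr rfl fun s _ => ?_
    split_ifs with h
    · exact Finset.mul_prod_erase _ _ h
    · simp
  · refine Finset.sum_bij' (fun s _ => s.erase j) (fun s _ => insert j s) ?_ ?_ ?_ ?_ ?_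
    · intro s hs
      simp only [Finset.mem_filter, Finset.mem_powersetCard_univ] at hs ⊢
      simp [Finset.card_erase_of_mem hs.2, hs.1]
    · intro s hs
      simp only [Finset.mem_filter, Finset.mem_powersetCard_univ] at hs ⊢
      simp [Finset.card_insert_of_notMem hs.2, hs.1]
    · intro s hs
      exact Finset.insert_erase (Finset.mem_filter.1 hs).2
    · intro s hs
      exact Finset.erase_insert (Finset.mem_filter.1 hs).2
    · intro s _
      rfl

/-- By the preceding recursion, raising the index by one multiplies the derivative by `-X j` modulo
`I`. -/
theorem pderiv_esymm_succ_sub_mem {σ R : Type*} [Fintype σ] [CommRing R]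
    {I : Ideal (MvPolynomial σ R)} (j : σ) (m : ℕ) (hI : ∀ k < m, esymm σ R (k + 1) ∈ I) :
    pderiv j (esymm σ R (m + 1)) - (-X j) ^ m ∈ I := by
  induction m with
  | zero =>
    have := pderiv_esymm_succ_add (R := R) j 0
    rw [esymm_zero, pderiv_one, mul_zero, add_zero] at this
    rw [this, pow_zero, sub_self]
    exact I.zero_mem
  | succ m ih =>
    have h := pderiv_esymm_succ_add (R := R) j (m + 1)
    have e : pderiv j (esymm σ R (m + 1 + 1)) - (-X j) ^ (m + 1) =
        esymm σ R (m + 1) - X j * (pderiv j (esymm σ R (m + 1)) - (-X j) ^ m) := by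
      linear_combination h
    rw [e]
    exact I.sub_mem (hI m (by omega)) (I.mul_mem_left _ (ih fun k hk => hI k (by omega)))

/-! ### Finite quotients and Krull's height theorem. -/

/-- If every variable satisfies, modulo `I`, an equation expressing `X j ^ e` through polynomials of
degree less than `e`, then the quotient by `I` is finite over the base ring. -/
theorem finite_quotient_of_X_pow {σ R : Type*} [Finite σ] [CommRing R]
    {I : Ideal (MvPolynomial σ R)} (e : ℕ)
    (h : ∀ j, ∃ r : MvPolynomial σ R, r.totalDegree < e ∧ X j ^ e - r ∈ I) :
    Module.Finite R (MvPolynomial σ R ⧸ I) := by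
  classical
  have := Fintype.ofFinite σ
  let b : σ →₀ ℕ := Finsupp.equivFunOnFinite.symm fun _ => e
  let B : Set (MvPolynomial σ R) := (fun s => monomial s 1) '' Set.Iic b
  let W : Submodule R (MvPolynomial σ R) := Submodule.span R B ⊔ I.restrictScalars R
  have key : ∀ N : ℕ, ∀ s : σ →₀ ℕ, s.sum (fun _ => id) = N → monomial s (1 : R) ∈ W := by
    intro N
    induction N using Nat.strong_induction_on with
    | _ N ih =>
      intro s hs
      by_cases hsb : s ≤ b
      · exact Submodule.mem_sup_left (Submodule.subset_span ⟨s, hsb, rfl⟩)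
      · obtain ⟨j, hj⟩ : ∃ j, e < s j := by
          rw [Finsupp.le_def] at hsb
          push Not at hsb
          simpa [b] using hsb
        obtain ⟨r, hr, hI⟩ := h j
        have hle : Finsupp.single j e ≤ s := by
          rw [Finsupp.single_le_iff]
          exact hj.le
        obtain ⟨u, rfl⟩ := exists_add_of_le hle
        -- Replacing `X j ^ e` by `r` strictly lowers the total degree, so the induction on degree
        -- applies to every resulting monomial.
        have e1 : monomial (Finsupp.single j e + u) (1 : R) =
            monomial u 1 * (X j ^ e - r) + monomial u 1 * r := by
          rw [X_pow_eq_monomial, mul_sub, monomial_mul, one_mul, add_comm u]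
          ring
        rw [e1]
        refine W.add_mem (Submodule.mem_sup_right (I.mul_mem_left _ hI)) ?_
        have hd : (monomial u (1 : R) * r).totalDegree < N := by
          refine (totalDegree_mul _ _).trans_lt ?_
          have h1 := totalDegree_monomial_le u (1 : R)
          rw [Finsupp.sum_add_index' (by simp) (by simp), Finsupp.sum_single_index rfl] at hs
          simp only [id] at hs
          change _ ≤ u.sum fun _ => id at h1
          change _ + (u.sum fun _ => id) = _ at hs
          omega
        rw [← support_sum_monomial_coeff (monomial u (1 : R) * r)]
        refine W.sum_mem fun v hv => ?_
        rw [← mul_one (coeff v _), ← smul_eq_mul, ← smul_monomial]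
        exact W.smul_mem _ (ih _ ((le_totalDegree hv).trans_lt hd) v rfl)
  have htop : W = ⊤ := by
    rw [eq_top_iff]
    intro p _
    rw [← support_sum_monomial_coeff p]
    refine W.sum_mem fun v _ => ?_
    rw [← mul_one (coeff v _), ← smul_eq_mul, ← smul_monomial]
    exact W.smul_mem _ (key _ v rfl)
  have hB : B.Finite := (Set.finite_Iic b).image _
  let q : MvPolynomial σ R →ₗ[R] MvPolynomial σ R ⧸ I := (Ideal.Quotient.mkₐ R I).toLinearMap
  refine ⟨Submodule.fg_def.2 ⟨q '' B, hB.image _, ?_⟩⟩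
  rw [← Submodule.map_span, eq_top_iff]
  rintro x -
  obtain ⟨p, rfl⟩ := Ideal.Quotient.mk_surjective x
  have hp : p ∈ W := htop ▸ Submodule.mem_top
  obtain ⟨y, hy, z, hz, rfl⟩ := Submodule.mem_sup.1 hp
  refine ⟨y, hy, ?_⟩
  change Ideal.Quotient.mk I y = _
  rw [map_add, Ideal.Quotient.eq_zero_iff_mem.2 hz, add_zero]

/-- The ideal of the origin in affine `n`-space has height at least `n`. -/
theorem le_height_ker_constantCoeff (n : ℕ) (R : Type*) [CommRing R] [IsDomain R] :
    (n : ℕ∞) ≤ (RingHom.ker (constantCoeff : MvPolynomial (Fin n) R →+* R)).height := by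
  -- `φ k` kills the first `k` variables; the kernels form a strict chain of primes.
  let φ : ℕ → MvPolynomial (Fin n) R →ₐ[R] MvPolynomial (Fin n) R := fun k =>
    aeval fun i => if (i : ℕ) < k then 0 else X i
  have key : ∀ k ≤ n, (k : ℕ∞) ≤ (RingHom.ker (φ k)).height := by
    intro k
    induction k with
    | zero => simp
    | succ k ih =>
      intro hk
      have hlt : RingHom.ker (φ k) < RingHom.ker (φ (k + 1)) := by
        refine lt_of_le_of_ne ?_ ?_
        · intro p hp
          have hcomp : φ (k + 1) = (φ (k + 1)).comp (φ k) := by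
            refine algHom_ext fun i => ?_
            simp only [φ, AlgHom.comp_apply, aeval_X]
            split_ifs <;> first | omega | simp_all
          rw [RingHom.mem_ker] at hp ⊢
          rw [hcomp, AlgHom.comp_apply, hp, map_zero]
        · intro heq
          have h1 : (X ⟨k, hk⟩ : MvPolynomial (Fin n) R) ∈ RingHom.ker (φ (k + 1)) := by
            simp [RingHom.mem_ker, φ]
          rw [← heq, RingHom.mem_ker] at h1
          simp [φ] at h1
      have := @Ideal.height_add_one_le_of_lt_of_isPrime _ _ _ _ (RingHom.ker_isPrime _)
        (RingHom.ker_isPrime _) hlt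
      push_cast
      exact (add_le_add_left (ih (by omega)) 1).trans this
  refine (key n le_rfl).trans (Ideal.height_mono fun p hp => ?_)
  rw [RingHom.mem_ker] at hp ⊢
  have h2 := congrArg constantCoeff hp
  have h3 : (constantCoeff : MvPolynomial (Fin n) R →+* R).comp (φ n).toRingHom = constantCoeff := by
    refine ringHom_ext (fun r => ?_) fun i => ?_ <;> simp [φ]
  rw [map_zero] at h2
  rw [← h3]
  exact h2

theorem card_le_of_finite_quotient {n : ℕ} {F : Type*} [Field F]
    (T : Finset (MvPolynomial (Fin n) F)) (hT : ∀ p ∈ T, constantCoeff p = 0)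
    [Module.Finite F (MvPolynomial (Fin n) F ⧸ Ideal.span (T : Set (MvPolynomial (Fin n) F)))] :
    n ≤ T.card := by
  have hmin : RingHom.ker (constantCoeff : MvPolynomial (Fin n) F →+* F) ∈
      (Ideal.span (T : Set (MvPolynomial (Fin n) F))).minimalPrimes := by
    refine ⟨⟨RingHom.ker_isPrime _, Ideal.span_le.2 hT⟩, ?_⟩
    -- A domain finite over a field is a field, so every prime containing `T` is maximal; hence the
    -- ideal of the origin is minimal over `T`.
    rintro p ⟨hp, hTp⟩ hle
    have : Module.Finite F (MvPolynomial (Fin n) F ⧸ p) :=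
      Module.Finite.of_surjective (Ideal.Quotient.factorₐ F hTp).toLinearMap
        (Ideal.Quotient.factor_surjective hTp)
    have hmax : p.IsMaximal := Ideal.Quotient.maximal_of_isField _
      (isField_of_isIntegral_of_isField' (R := F) (Field.toIsField F))
    exact (hmax.eq_of_le (RingHom.ker_ne_top _) hle).ge
  have h := (le_height_ker_constantCoeff n F).trans
    (Ideal.height_le_card_of_mem_minimalPrimes_span_finset hmin)
  exact_mod_cast h

theorem constantCoeff_esymm_succ {σ R : Type*} [Fintype σ] [CommRing R] (k : ℕ) :
    constantCoeff (esymm σ R (k + 1)) = 0 := by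
  rw [esymm, map_sum]
  refine Finset.sum_eq_zero fun s hs => ?_
  rw [Finset.mem_powersetCard_univ] at hs
  simp [map_prod, Finset.prod_const, hs]

/-- An elementary symmetric polynomial is, up to lower degree terms, in the square of an ideal of
polynomials vanishing at the origin only if that ideal has many generators. -/
theorem le_card_add_of_esymm_sub_mem_sq {n e : ℕ} {F : Type*} [Field F] (he : 0 < e)
    (S : Finset (MvPolynomial (Fin n) F)) (hS : ∀ p ∈ S, constantCoeff p = 0)
    (r : MvPolynomial (Fin n) F) (hr : r.totalDegree < e + 1)
    (h : esymm (Fin n) F (e + 1) - r ∈ Ideal.span (S : Set (MvPolynomial (Fin n) F)) ^ 2) :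
    n ≤ S.card + e := by
  classical
  let T := S ∪ (Finset.range e).image fun k => esymm (Fin n) F (k + 1)
  have hST : Ideal.span (S : Set (MvPolynomial (Fin n) F)) ≤ Ideal.span (T : Set _) :=
    Ideal.span_mono (by simp [T])
  have hfin : Module.Finite F (MvPolynomial (Fin n) F ⧸
      Ideal.span (T : Set (MvPolynomial (Fin n) F))) := by
    -- Differentiating `esymm (e + 1) - r` gives `(-X j) ^ e - pderiv j r` modulo `T`; the sign is
    -- moved to `r`.
    refine finite_quotient_of_X_pow e fun j => ⟨(-1) ^ e * pderiv j r, ?_, ?_⟩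
    · have : ((-1) ^ e * pderiv j r : MvPolynomial (Fin n) F) = C ((-1) ^ e) * pderiv j r := by simp
      rw [this, C_mul']
      exact (totalDegree_smul_le _ _).trans_lt (totalDegree_pderiv_lt j he hr)
    · have h1 := hST ((pderiv j).mem_of_mem_sq h)
      have h2 := pderiv_esymm_succ_sub_mem
        (I := Ideal.span (T : Set (MvPolynomial (Fin n) F))) j e fun k hk =>
        Ideal.subset_span (Finset.mem_coe.2 (Finset.mem_union_right _
          (Finset.mem_image_of_mem _ (Finset.mem_range.2 hk))))
      have h3 := Ideal.mul_mem_left _ ((-1) ^ e) (Ideal.sub_mem _ h1 h2)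
      rw [map_sub, neg_pow (X j : MvPolynomial (Fin n) F)] at h3
      convert h3 using 1
      have h4 : ((-1) ^ e * (-1) ^ e : MvPolynomial (Fin n) F) = 1 := by
        rw [← mul_pow]
        simp
      linear_combination (-X j ^ e) * h4
  have hT : ∀ p ∈ T, constantCoeff p = 0 := by
    intro p hp
    rcases Finset.mem_union.1 hp with hp | hp
    · exact hS p hp
    · obtain ⟨k, -, rfl⟩ := Finset.mem_image.1 hp
      exact constantCoeff_esymm_succ k
  refine (card_le_of_finite_quotient T hT).trans ((Finset.card_union_le _ _).trans ?_)
  exact Nat.add_le_add_left (Finset.card_image_le.trans (Finset.card_range e).le) _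

end MvPolynomial

/-! ### Decomposing formulas by formal degree. -/

namespace AlgFormula

/-- The formal degree of a formula: an upper bound for the degree of the computed polynomial. -/
def formalDegree {F σ : Type*} : AlgFormula F σ → ℕ
  | var _ => 1
  | const _ => 0
  | add Φ Ψ => max Φ.formalDegree Ψ.formalDegree
  | mul Φ Ψ => Φ.formalDegree + Ψ.formalDegree

theorem formalDegree_le_size {F σ : Type*} (Φ : AlgFormula F σ) : Φ.formalDegree ≤ Φ.size := by
  induction Φ with
  | var i => exact le_rfl
  | const a => exact le_rfl
  | add Φ Ψ h1 h2 => simp only [formalDegree, size]; omega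
  | mul Φ Ψ h1 h2 => simp only [formalDegree, size]; omega

theorem totalDegree_toPoly_le {F σ : Type*} [CommRing F] [Nontrivial F] (Φ : AlgFormula F σ) :
    Φ.toPoly.totalDegree ≤ Φ.formalDegree := by
  induction Φ with
  | var i => exact (totalDegree_X i).le
  | const a => exact (totalDegree_C a).le
  | add Φ Ψ h1 h2 => exact (totalDegree_add _ _).trans (max_le_max h1 h2)
  | mul Φ Ψ h1 h2 => exact (totalDegree_mul _ _).trans (add_le_add h1 h2)

/-- From a formula of formal degree at least `D` one can split off a subformula of formal degree
between `D` and `2 * D`, at the gain of `D` leaves. -/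
theorem exists_split {F σ : Type*} [CommRing F] [Nontrivial F] {D : ℕ} (hD : 0 < D)
    (Φ : AlgFormula F σ) (h : D ≤ Φ.formalDegree) :
    ∃ (A V : MvPolynomial σ F) (Ψ : AlgFormula F σ), Φ.toPoly = A * V + Ψ.toPoly ∧
      constantCoeff V = 0 ∧ V.totalDegree < 2 * D ∧ Ψ.size + D ≤ Φ.size := by
  induction Φ with
  | var i =>
    simp only [formalDegree] at h
    refine ⟨1, X i, const 0, by simp [toPoly], by simp, ?_, by simpa [size] using h⟩
    rw [totalDegree_X]
    omega
  | const a =>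
    simp only [formalDegree] at h
    omega
  | add Φ₁ Φ₂ ih₁ ih₂ =>
    simp only [formalDegree, le_max_iff] at h
    rcases h with h | h
    · obtain ⟨A, V, Ψ, h1, h2, h3, h4⟩ := ih₁ h
      refine ⟨A, V, add Ψ Φ₂, ?_, h2, h3, ?_⟩
      · simp only [toPoly, h1]; ring
      · simp only [size]; omega
    · obtain ⟨A, V, Ψ, h1, h2, h3, h4⟩ := ih₂ h
      refine ⟨A, V, add Φ₁ Ψ, ?_, h2, h3, ?_⟩
      · simp only [toPoly, h1]; ring
      · simp only [size]; omega
  | mul Φ₁ Φ₂ ih₁ ih₂ =>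
    by_cases hl₁ : D ≤ Φ₁.formalDegree
    · obtain ⟨A, V, Ψ, h1, h2, h3, h4⟩ := ih₁ hl₁
      refine ⟨A * Φ₂.toPoly, V, mul Ψ Φ₂, ?_, h2, h3, ?_⟩
      · simp only [toPoly, h1]; ring
      · simp only [size]; omega
    by_cases hl₂ : D ≤ Φ₂.formalDegree
    · obtain ⟨A, V, Ψ, h1, h2, h3, h4⟩ := ih₂ hl₂
      refine ⟨A * Φ₁.toPoly, V, mul Φ₁ Ψ, ?_, h2, h3, ?_⟩
      · simp only [toPoly, h1]; ring
      · simp only [size]; omega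
    -- Both factors have formal degree below `D`, so the product has formal degree in `[D, 2 * D)`
    -- and is cut out whole; only its constant term, a leaf of size zero, stays behind.
    have hs := formalDegree_le_size (mul Φ₁ Φ₂)
    have hd := totalDegree_toPoly_le (mul Φ₁ Φ₂)
    refine ⟨1, (mul Φ₁ Φ₂).toPoly - C (constantCoeff (mul Φ₁ Φ₂).toPoly),
      const (constantCoeff (mul Φ₁ Φ₂).toPoly), ?_, ?_, ?_, ?_⟩
    · simp [toPoly]
    · simp
    · refine (totalDegree_sub_C_le _ _).trans_lt (hd.trans_lt ?_)
      simp only [formalDegree]; omega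
    · simp only [formalDegree, size] at h hs ⊢; omega

/-- Up to terms of degree less than `2 * D`, the polynomial computed by a formula lies in the square
of an ideal generated by few polynomials vanishing at the origin. -/
theorem exists_sub_mem_sq {F σ : Type*} [CommRing F] [Nontrivial F] {D : ℕ} (hD : 0 < D)
    (Φ : AlgFormula F σ) :
    ∃ (t : ℕ) (S : Finset (MvPolynomial σ F)) (r : MvPolynomial σ F),
      t * D ≤ Φ.size ∧ S.card ≤ 2 * t ∧ (∀ p ∈ S, constantCoeff p = 0) ∧
      r.totalDegree < 2 * D ∧ Φ.toPoly - r ∈ Ideal.span (S : Set (MvPolynomial σ F)) ^ 2 := by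
  classical
  induction hs : Φ.size using Nat.strong_induction_on generalizing Φ with
  | _ s ih =>
    subst hs
    by_cases h : D ≤ Φ.formalDegree
    · obtain ⟨A, V, Ψ, h1, h2, h3, h4⟩ := exists_split hD Φ h
      obtain ⟨t, S, r, g1, g2, g3, g4, g5⟩ := ih _ (by omega) Ψ rfl
      -- Only `A' * V` has to lie in the square of the ideal: the constant multiple of `V` has
      -- degree below `2 * D` and joins the remainder.
      let A' := A - C (constantCoeff A)
      have hsub : Ideal.span (S : Set (MvPolynomial σ F)) ≤
          Ideal.span ((insert A' (insert V S) : Finset _) : Set _) :=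
        Ideal.span_mono (by
          intro x hx
          simp only [Finset.coe_insert, Set.mem_insert_iff]
          exact Or.inr (Or.inr hx))
      refine ⟨t + 1, insert A' (insert V S), C (constantCoeff A) * V + r, ?_, ?_, ?_, ?_, ?_⟩
      · rw [add_mul]; omega
      · have e1 := Finset.card_insert_le A' (insert V S)
        have e2 := Finset.card_insert_le V S
        omega
      · intro p hp
        rcases Finset.mem_insert.1 hp with rfl | hp
        · simp [A']
        rcases Finset.mem_insert.1 hp with rfl | hp
        · exact h2
        · exact g3 p hp
      · refine (totalDegree_add _ _).trans_lt (max_lt ?_ g4)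
        rw [C_mul']
        exact (totalDegree_smul_le _ _).trans_lt h3
      · have e : Φ.toPoly - (C (constantCoeff A) * V + r) = A' * V + (Ψ.toPoly - r) := by
          simp only [h1, A']; ring
        rw [e]
        refine Ideal.add_mem _ ?_ (Ideal.pow_right_mono hsub 2 g5)
        rw [pow_two]
        exact Ideal.mul_mem_mul (Ideal.subset_span (by simp)) (Ideal.subset_span (by simp))
    · refine ⟨0, ∅, Φ.toPoly, by simp, by simp, by simp, ?_, by simp⟩
      have := totalDegree_toPoly_le Φ
      omega

/-! ### Ben-Or's upper bound by interpolation. -/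

theorem exists_sum {F σ ι : Type*} [CommSemiring F] (s : Finset ι) (f : ι → MvPolynomial σ F)
    (B : ℕ) (h : ∀ i ∈ s, ∃ Φ : AlgFormula F σ, Φ.toPoly = f i ∧ Φ.numVertices ≤ B) :
    ∃ Φ : AlgFormula F σ, Φ.toPoly = ∑ i ∈ s, f i ∧ Φ.numVertices ≤ s.card * (B + 1) + 1 := by
  classical
  induction s using Finset.induction_on with
  | empty => exact ⟨const 0, by simp [toPoly], by simp [numVertices]⟩
  | insert a s ha ih =>
    obtain ⟨Φ, h1, h2⟩ := h a (by simp)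
    obtain ⟨Ψ, g1, g2⟩ := ih fun i hi => h i (Finset.mem_insert_of_mem hi)
    refine ⟨add Φ Ψ, by simp [toPoly, h1, g1, Finset.sum_insert ha], ?_⟩
    simp only [numVertices, Finset.card_insert_of_notMem ha]
    rw [Nat.add_one_mul]
    omega

theorem exists_prod {F σ ι : Type*} [CommSemiring F] (s : Finset ι) (f : ι → MvPolynomial σ F)
    (B : ℕ) (h : ∀ i ∈ s, ∃ Φ : AlgFormula F σ, Φ.toPoly = f i ∧ Φ.numVertices ≤ B) :
    ∃ Φ : AlgFormula F σ, Φ.toPoly = ∏ i ∈ s, f i ∧ Φ.numVertices ≤ s.card * (B + 1) + 1 := by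
  classical
  induction s using Finset.induction_on with
  | empty => exact ⟨const 1, by simp [toPoly], by simp [numVertices]⟩
  | insert a s ha ih =>
    obtain ⟨Φ, h1, h2⟩ := h a (by simp)
    obtain ⟨Ψ, g1, g2⟩ := ih fun i hi => h i (Finset.mem_insert_of_mem hi)
    refine ⟨mul Φ Ψ, by simp [toPoly, h1, g1, Finset.prod_insert ha], ?_⟩
    simp only [numVertices, Finset.card_insert_of_notMem ha]
    rw [Nat.add_one_mul]
    omega

end AlgFormula

theorem MvPolynomial.prod_one_add_C_mul_X {σ R : Type*} [Fintype σ] [CommSemiring R] (a : R) :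
    ∏ i : σ, (1 + C a * X i : MvPolynomial σ R) =
      ∑ m ∈ Finset.range (Fintype.card σ + 1), C (a ^ m) * esymm σ R m := by
  rw [Finset.prod_one_add, Finset.sum_powerset, Finset.card_univ]
  refine Finset.sum_congr rfl fun m _ => ?_
  rw [esymm, Finset.mul_sum]
  refine Finset.sum_congr rfl fun t ht => ?_
  rw [Finset.prod_mul_distrib, Finset.prod_const, (Finset.mem_powersetCard_univ.1 ht), C_pow]

/-- Interpolation on `s` reproduces `X ^ m` exactly when `m < s.card`; compare coefficients of
degree `d`. -/
theorem Lagrange.sum_pow_mul_coeff_basis {F : Type*} [Field F] [DecidableEq F] (s : Finset F)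
    {m : ℕ} (hm : m < s.card) (d : ℕ) :
    ∑ a ∈ s, a ^ m * (Lagrange.basis s id a).coeff d = if d = m then 1 else 0 := by
  have h := Lagrange.eq_interpolate (f := (Polynomial.X ^ m : Polynomial F)) (s := s) (v := id)
    (Function.injective_id.injOn) (by simpa using hm)
  have h2 := congrArg (fun p => Polynomial.coeff p d) h
  simp only [Lagrange.interpolate_apply, Polynomial.finsetSum_coeff, Polynomial.coeff_C_mul,
    Polynomial.coeff_X_pow, Polynomial.eval_pow, Polynomial.eval_X, id] at h2
  exact h2.symm

theorem AlgFormula.exists_esymm {F : Type*} [Field F] {n d : ℕ} (hd : d ≤ n)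
    (hF : (n : ℕ∞) < ENat.card F) :
    ∃ Φ : AlgFormula F (Fin n), Φ.toPoly = esymm (Fin n) F d ∧
      Φ.numVertices ≤ (n + 1) * (6 * n + 4) + 1 := by
  classical
  obtain ⟨t, -, ht⟩ := Set.exists_subset_encard_eq (s := (Set.univ : Set F)) (k := (n + 1 : ℕ))
    (by rw [Set.encard_univ]; exact_mod_cast Order.add_one_le_of_lt hF)
  have htf : t.Finite := Set.finite_of_encard_eq_coe ht
  obtain ⟨s, rfl⟩ := htf.exists_finset_coe
  rw [Set.encard_coe_eq_coe_finsetCard] at ht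
  have hs : s.card = n + 1 := by exact_mod_cast ht
  obtain ⟨Φ, h1, h2⟩ := exists_sum s
    (fun a => C ((Lagrange.basis s id a).coeff d) * ∏ i : Fin n, (1 + C a * X i))
    -- Each factor `1 + a * X i` has 5 vertices, their product at most `6 * n + 1`, and scaling adds
    -- 2.
    (6 * n + 3) (by
      intro a _
      obtain ⟨Ψ, g1, g2⟩ := exists_prod (Finset.univ : Finset (Fin n))
        (fun i => (1 + C a * X i : MvPolynomial (Fin n) F)) 5 fun i _ =>
          ⟨add (const 1) (mul (const a) (var i)), by simp [toPoly], by simp [numVertices]⟩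
      refine ⟨mul (const _) Ψ, by rw [toPoly, toPoly, g1], ?_⟩
      simp only [numVertices, Finset.card_univ, Fintype.card_fin] at g2 ⊢
      omega)
  refine ⟨Φ, ?_, by rw [hs] at h2; exact h2⟩
  rw [h1]
  simp_rw [prod_one_add_C_mul_X, Fintype.card_fin, Finset.mul_sum]
  rw [Finset.sum_comm, Finset.sum_eq_single_of_mem d (by simp; omega)]
  · simp_rw [← mul_assoc, ← C_mul, ← Finset.sum_mul, ← map_sum]
    simp_rw [mul_comm _ (_ ^ d)]
    rw [Lagrange.sum_pow_mul_coeff_basis s (by omega), if_pos rfl, C_1, one_mul]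
  · intro m hm hmd
    simp_rw [← mul_assoc, ← C_mul, ← Finset.sum_mul, ← map_sum]
    simp_rw [mul_comm _ (_ ^ m)]
    rw [Lagrange.sum_pow_mul_coeff_basis s (by simp at hm; omega), if_neg hmd.symm, C_0, zero_mul]

/-- Formulas for the elementary symmetric polynomials, over any field: the size is at least
of the order of `d * (n - d)`. -/
theorem AlgFormula.exists_mul_le_size {F : Type*} [Field F] {n d : ℕ} (hd : 2 ≤ d)
    (Φ : AlgFormula F (Fin n)) (hΦ : Φ.toPoly = esymm (Fin n) F d) :
    ∃ t, t * (d / 2) ≤ Φ.size ∧ n < 2 * t + d := by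
  -- With `D = d / 2` the remainder has degree below `2 * D ≤ d`.
  obtain ⟨t, S, r, h1, h2, h3, h4, h5⟩ := exists_sub_mem_sq (D := d / 2) (by omega) Φ
  obtain ⟨e, rfl⟩ : ∃ e, d = e + 1 := ⟨d - 1, by omega⟩
  rw [hΦ] at h5
  have := le_card_add_of_esymm_sub_mem_sq (by omega) S h3 r (by omega) h5
  exact ⟨t, h1, by omega⟩

end

theorem theorem1p3 :
    ∃ c C : ℝ, 0 < c ∧ 0 < C ∧ ∃ N : ℕ, ∀ n : ℕ, N ≤ n →
      ∀ d : ℕ, (d = ⌊(n : ℝ) / 10⌋₊ ∨ d = ⌈(n : ℝ) / 10⌉₊) →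
      ∀ (F : Type*) [Field F],
        -- every formula for `esym(n, 0.1n)` has size at least `c n²`
        ((ringChar F = 0 ∨ (n : ℝ) / 10 < (ringChar F : ℝ)) →
          ∀ Φ : AlgFormula F (Fin n), Φ.toPoly = MvPolynomial.esymm (Fin n) F d →
            c * (n : ℝ) ^ 2 ≤ (Φ.size : ℝ)) ∧
        -- the matching upper bound, over fields with more than `n` elements
        ((n : ℕ∞) < ENat.card F →
          ∃ Φ : AlgFormula F (Fin n), Φ.toPoly = MvPolynomial.esymm (Fin n) F d ∧
            (Φ.numVertices : ℝ) ≤ C * (n : ℝ) ^ 2) := by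
  -- `160 = 4 * 40`, from `n ≤ 4 * t` and `n ≤ 40 * (d / 2)`; `21 = 6 + 10 + 5` bounds `6 * n ^ 2 +
  -- 10 * n + 5`.
  refine ⟨1 / 160, 21, by norm_num, by norm_num, 40, fun n hn d hd F _ => ?_⟩
  have hn' : (40 : ℝ) ≤ n := by exact_mod_cast hn
  have hn0 : (0 : ℝ) ≤ (n : ℝ) / 10 := by positivity
  have hd1 : (n : ℝ) / 10 < d + 1 := by
    rcases hd with rfl | rfl
    · exact Nat.lt_floor_add_one _
    · linarith [Nat.le_ceil ((n : ℝ) / 10)]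
  have hd2 : (d : ℝ) < n / 10 + 1 := by
    rcases hd with rfl | rfl
    · linarith [Nat.floor_le hn0]
    · exact Nat.ceil_lt_add_one hn0
  have hd3 : n < 10 * d + 10 := by
    have : (n : ℝ) < 10 * d + 10 := by linarith
    exact_mod_cast this
  have hd4 : 10 * d < n + 10 := by
    have : 10 * (d : ℝ) < n + 10 := by linarith
    exact_mod_cast this
  refine ⟨fun _ Φ hΦ => ?_, fun hF => ?_⟩
  · obtain ⟨t, h1, h2⟩ := AlgFormula.exists_mul_le_size (by omega) Φ hΦ
    have ht : n ≤ 4 * t := by omega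
    have hh : n ≤ 40 * (d / 2) := by omega
    have h3 : n * n ≤ 4 * t * (40 * (d / 2)) := Nat.mul_le_mul ht hh
    have h4 : n * n ≤ 160 * Φ.size := by nlinarith
    have h5 : (n : ℝ) * n ≤ 160 * Φ.size := by exact_mod_cast h4
    linarith [pow_two (n : ℝ)]
  · obtain ⟨Φ, h1, h2⟩ := AlgFormula.exists_esymm (d := d) (by omega) hF
    refine ⟨Φ, h1, ?_⟩
    have h3 : (Φ.numVertices : ℝ) ≤ (n + 1) * (6 * n + 4) + 1 := by exact_mod_cast h2
    nlinarith
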